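/- Let $G$ be a finite group and let $X$ be a separable real Banach space (of finite or infinite dimension) such that $\dim X \ge |G|$. Then the group $\{-1,1\}\times G$ is representable in $X$; that is, there exists a norm $p$ on $X$ equivalent to the given norm (there are constants $c,C>0$ with $c\|x\|\le p(x)\le C\|x\|$ for all $x\in X$) such that the group of all surjective linear isometries of $(X,p)$ onto itself is isomorphic, as a group, to $\{-1,1\}\times G$. -/

import Mathlib

/-- `p` is an equivalent norm on the real normed space `X`: there are constants `c, C > 0` with
`c * ‖x‖ ≤ p x ≤ C * ‖x‖` for all `x`. The lower bound makes the seminorm `p` a norm. -/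
def IsEquivalentNorm {X : Type*} [NormedAddCommGroup X] [NormedSpace ℝ X]
    (p : Seminorm ℝ X) : Prop :=
  ∃ c C : ℝ, 0 < c ∧ 0 < C ∧ ∀ x : X, c * ‖x‖ ≤ p x ∧ p x ≤ C * ‖x‖

/-- The group (under composition) of all surjective linear isometries of `X` equipped with `p`. -/
def isometryGroup {X : Type*} [AddCommGroup X] [Module ℝ X] (p : Seminorm ℝ X) :
    Subgroup (X ≃ₗ[ℝ] X) where
  carrier := {T | ∀ x, p (T x) = p x}
  one_mem' := fun _ => rfl
  mul_mem' := fun {S T} hS hT x => (hS (T x)).trans (hT x)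
  inv_mem' := fun {T} hT x => by
    have h := hT (T.symm x)
    rw [LinearEquiv.apply_symm_apply] at h
    exact h.symm

/-- A group `H` is representable in the real normed space `X` if there is an equivalent norm on `X`
whose full group of linear isometries is isomorphic to `H`. -/
def IsRepresentableIn (H : Type*) [Group H] (X : Type*) [NormedAddCommGroup X]
    [NormedSpace ℝ X] : Prop :=
  ∃ p : Seminorm ℝ X, IsEquivalentNorm p ∧ Nonempty (H ≃* isometryGroup p)

open Filter Topology

/-! The norm is `p = Q + ∑ |φ i|`: a Gateaux smooth, `G`-invariant norm `Q` plus countably many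
kinks, the kernels of functionals `φ i`. At `x ≠ 0` the second difference quotients of `p` in
direction `h` tend to `2 ∑ |φ i h|` over those `i` with `φ i x = 0`, so every isometry must respect
the kinks. By Baire some point lies in exactly one prescribed kernel, and comparing limits there
shows that an isometry permutes the `φ i` up to sign (`exists_apply_isometry_eq`).

The smooth norm comes from an infimal convolution with a Hilbert norm of dense range, averaged over
an action of `G` that permutes a finite biorthogonal system `u`, `e`. The functionals are chosen so
that only signed group elements survive. Weights dropping sharply between classes of functionals
(`exists_weights`) prevent an isometry from mixing classes, since it distorts dual norms by a
bounded factor. Within classes (`exists_signedShift_of_permutes_features`), the coordinates `e g`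
are permuted with signs; the translates of a combination with distinct positive coefficients force
this permutation to be a translation with one common sign; the `ψ k` are preserved up to sign, and
`∑ h, e h + ψ k` ties that sign to the common one. Totality then determines the operator. -/

/-- The symmetric second difference quotients of `q` at nonzero points tend to zero. For a
seminorm this says that `q` is Gateaux differentiable away from the origin. -/
def IsGateauxSmooth {X : Type*} [AddCommGroup X] [Module ℝ X] (q : Seminorm ℝ X) : Prop :=
  ∀ x : X, x ≠ 0 → ∀ h : X,
    Tendsto (fun t : ℝ => (q (x + t • h) + q (x - t • h) - 2 * q x) / t) (𝓝[>] 0) (𝓝 0)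

/-! ### Gateaux smooth renorming of separable Banach spaces -/

section SmoothNorm

variable {X : Type*} [NormedAddCommGroup X] [NormedSpace ℝ X]

theorem IsEquivalentNorm.pos {q : Seminorm ℝ X} (hq : IsEquivalentNorm q) {x : X} (hx : x ≠ 0) :
    0 < q x := by
  obtain ⟨c, C, hc, -, h⟩ := hq
  exact lt_of_lt_of_le (mul_pos hc (norm_pos_iff.2 hx)) (h x).1

theorem Seminorm.second_difference_nonneg (q : Seminorm ℝ X) (x h : X) :
    0 ≤ q (x + h) + q (x - h) - 2 * q x := by
  have h1 := map_add_le_add q (x + h) (x - h)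
  have h2 : x + h + (x - h) = (2 : ℝ) • x := by rw [two_smul]; abel
  rw [h2, map_smul_eq_mul, Real.norm_eq_abs, abs_of_pos two_pos] at h1
  linarith

/-- The infimal convolution, in the `ℓ²` sense, of the norm of `X` with the image under `L` of the
norm of `H`. -/
noncomputable def infConvNorm {H : Type*} [NormedAddCommGroup H] [NormedSpace ℝ H]
    (L : H →L[ℝ] X) : Seminorm ℝ X :=
  Seminorm.ofSMulLE (fun x => ⨅ a : H, ‖WithLp.toLp 2 (x - L a, a)‖)
    (le_antisymm (ciInf_le_of_le ⟨0, by rintro _ ⟨a, rfl⟩; exact norm_nonneg _⟩ 0 (by simp))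
      (Real.iInf_nonneg fun _ => norm_nonneg _))
    (fun x y => by
      refine le_ciInf_add_ciInf fun a b => ?_
      refine (ciInf_le ⟨0, by rintro _ ⟨a, rfl⟩; exact norm_nonneg _⟩ (a + b)).trans ?_
      refine le_of_eq_of_le ?_ (norm_add_le _ _)
      rw [← WithLp.toLp_add, Prod.mk_add_mk, map_add]
      congr 3
      abel)
    (fun r x => by
      rw [Real.mul_iInf_of_nonneg (norm_nonneg r)]
      refine le_ciInf fun a => ?_
      refine (ciInf_le ⟨0, by rintro _ ⟨a, rfl⟩; exact norm_nonneg _⟩ (r • a)).trans ?_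
      rw [← norm_smul, ← WithLp.toLp_smul, Prod.smul_mk, map_smul, smul_sub])

variable {H : Type*} [NormedAddCommGroup H]

theorem infConvNorm_le [NormedSpace ℝ H] (L : H →L[ℝ] X) (x : X) (a : H) :
    infConvNorm L x ≤ ‖WithLp.toLp 2 (x - L a, a)‖ :=
  ciInf_le (f := fun a : H => ‖WithLp.toLp 2 (x - L a, a)‖)
    ⟨0, by rintro _ ⟨a, rfl⟩; exact norm_nonneg _⟩ a

theorem le_infConvNorm [NormedSpace ℝ H] (L : H →L[ℝ] X) (x : X) {r : ℝ}
    (h : ∀ a, r ≤ ‖WithLp.toLp 2 (x - L a, a)‖) : r ≤ infConvNorm L x :=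
  le_ciInf h

theorem infConvNorm_sq_le [NormedSpace ℝ H] (L : H →L[ℝ] X) (x : X) (a : H) :
    infConvNorm L x ^ 2 ≤ ‖x - L a‖ ^ 2 + ‖a‖ ^ 2 := by
  refine (pow_le_pow_left₀ (apply_nonneg _ _) (infConvNorm_le L x a) 2).trans_eq ?_
  exact WithLp.prod_norm_sq_eq_of_L2 _

theorem isEquivalentNorm_infConvNorm [NormedSpace ℝ H] (L : H →L[ℝ] X) :
    IsEquivalentNorm (infConvNorm L) := by
  have hpos : 0 < 1 + ‖L‖ := by positivity
  refine ⟨(1 + ‖L‖)⁻¹, 1, inv_pos.2 hpos, one_pos, fun x => ⟨le_infConvNorm L x fun a => ?_, ?_⟩⟩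
  · rw [inv_mul_le_iff₀ hpos]
    have h1 : ‖x - L a‖ ≤ ‖WithLp.toLp 2 (x - L a, a)‖ := by
      refine abs_le_of_sq_le_sq' ?_ (norm_nonneg _) |>.2
      rw [WithLp.prod_norm_sq_eq_of_L2]
      exact le_add_of_nonneg_right (sq_nonneg _)
    have h2 : ‖a‖ ≤ ‖WithLp.toLp 2 (x - L a, a)‖ := by
      refine abs_le_of_sq_le_sq' ?_ (norm_nonneg _) |>.2
      rw [WithLp.prod_norm_sq_eq_of_L2]
      exact le_add_of_nonneg_left (sq_nonneg _)
    calc ‖x‖ = ‖(x - L a) + L a‖ := by rw [sub_add_cancel]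
      _ ≤ ‖x - L a‖ + ‖L‖ * ‖a‖ := (norm_add_le _ _).trans (by gcongr; exact L.le_opNorm a)
      _ ≤ _ := by
        rw [add_mul, one_mul]
        gcongr
  · have h := infConvNorm_sq_le L x 0
    simp only [map_zero, sub_zero, norm_zero] at h
    rw [one_mul]
    exact abs_le_of_sq_le_sq' (by linarith) (norm_nonneg _) |>.2

/-- Moving the competitor `a` to `a ± b` leaves `x - L a` unchanged, so only the Hilbert term
varies, and the parallelogram law controls it. -/
theorem infConvNorm_sq_second_difference_le [InnerProductSpace ℝ H] (L : H →L[ℝ] X) (x : X)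
    (b : H) :
    infConvNorm L (x + L b) ^ 2 + infConvNorm L (x - L b) ^ 2 ≤
      2 * infConvNorm L x ^ 2 + 2 * ‖b‖ ^ 2 := by
  set A := infConvNorm L (x + L b) ^ 2 + infConvNorm L (x - L b) ^ 2 with hA
  have key : ∀ a, A ≤ 2 * ‖WithLp.toLp 2 (x - L a, a)‖ ^ 2 + 2 * ‖b‖ ^ 2 := fun a => by
    have h1 := infConvNorm_sq_le L (x + L b) (a + b)
    have h2 := infConvNorm_sq_le L (x - L b) (a - b)
    rw [map_add L, add_sub_add_right_eq_sub] at h1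
    rw [map_sub L, sub_sub_sub_cancel_right] at h2
    have h3 := parallelogram_law_with_norm ℝ a b
    rw [WithLp.prod_norm_sq_eq_of_L2]
    change A ≤ 2 * (‖x - L a‖ ^ 2 + ‖a‖ ^ 2) + 2 * ‖b‖ ^ 2
    linarith
  -- The square root turns the bounds for all `a` into a lower bound for the infimum; its value `0`
  -- at negative numbers makes a sign condition unnecessary.
  have h : √(A / 2 - ‖b‖ ^ 2) ≤ infConvNorm L x :=
    le_infConvNorm L x fun a => Real.sqrt_le_left (norm_nonneg _) |>.2 (by linarith [key a])
  have := (Real.sqrt_le_left (apply_nonneg _ _)).1 h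
  linarith

theorem isGateauxSmooth_infConvNorm [InnerProductSpace ℝ H] (L : H →L[ℝ] X)
    (hL : DenseRange L) : IsGateauxSmooth (infConvNorm L) := by
  intro x hx h
  set q := infConvNorm L with hq
  have hqx : 0 < q x := (isEquivalentNorm_infConvNorm L).pos hx
  obtain ⟨c, C, hc, hC, hcC⟩ := isEquivalentNorm_infConvNorm L
  rw [Metric.tendsto_nhds]
  intro ε hε
  -- Replacing `h` by `L b` costs `t * (ε / 4)` in each of two terms; the remaining `ε / 2` absorbs
  -- the part quadratic in `t`.
  obtain ⟨b, hb⟩ := hL.exists_dist_lt h (show 0 < ε / (4 * C) by positivity)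
  rw [dist_eq_norm] at hb
  have hlim : Tendsto (fun t : ℝ => t * ‖b‖ ^ 2 / q x) (𝓝[>] 0) (𝓝 0) := by
    refine tendsto_nhdsWithin_of_tendsto_nhds ?_
    have : Continuous fun t : ℝ => t * ‖b‖ ^ 2 / q x := by fun_prop
    simpa using this.tendsto 0
  filter_upwards [self_mem_nhdsWithin, hlim.eventually_lt_const (half_pos hε)] with t ht hlt
  have ht : 0 < t := ht
  have h0 := q.second_difference_nonneg x (t • h)
  rw [dist_zero_right, Real.norm_eq_abs, abs_of_nonneg (div_nonneg h0 ht.le), div_lt_iff₀ ht]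
  have hs := infConvNorm_sq_second_difference_le L x (t • b)
  rw [← hq, map_smul, norm_smul, Real.norm_eq_abs, abs_of_pos ht, mul_pow] at hs
  have h1 : q (x + t • L b) + q (x - t • L b) - 2 * q x ≤ t * (t * ‖b‖ ^ 2 / q x) := by
    rw [← mul_div_assoc, le_div_iff₀ hqx]
    -- The bound on squares is linearised by `s ^ 2 ≥ 2 * s * q x - q x ^ 2`.
    nlinarith [sq_nonneg (q (x + t • L b) - q x), sq_nonneg (q (x - t • L b) - q x)]
  have hd : q (t • (h - L b)) ≤ t * (ε / 4) := by
    rw [map_smul_eq_mul, Real.norm_eq_abs, abs_of_pos ht]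
    refine mul_le_mul_of_nonneg_left ((hcC _).2.trans ?_) ht.le
    calc C * ‖h - L b‖ ≤ C * (ε / (4 * C)) := by gcongr
      _ = ε / 4 := by field_simp
  have h2 : q (x + t • h) ≤ q (x + t • L b) + t * (ε / 4) := by
    refine le_trans (le_of_eq_of_le ?_ (map_add_le_add q (x + t • L b) (t • (h - L b))))
      (by gcongr)
    congr 1; rw [smul_sub]; abel
  have h3 : q (x - t • h) ≤ q (x - t • L b) + t * (ε / 4) := by
    refine le_trans (le_of_eq_of_le ?_ (map_sub_le_add q (x - t • L b) (t • (h - L b))))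
      (by gcongr)
    congr 1; rw [smul_sub]; abel
  have h4 := mul_lt_mul_of_pos_left hlt ht
  nlinarith

/-- Every separable Banach space is the closure of the range of a bounded operator on `ℓ²`. -/
theorem exists_denseRange_lp_two (X : Type*) [NormedAddCommGroup X] [NormedSpace ℝ X]
    [CompleteSpace X] [TopologicalSpace.SeparableSpace X] :
    ∃ L : lp (fun _ : ℕ => ℝ) 2 →L[ℝ] X, DenseRange L := by
  set x : ℕ → X := TopologicalSpace.denseSeq X
  set r : ℕ → ℝ := fun k => (1 / 2) ^ k / (1 + ‖x k‖)
  have hr : ∀ k, 0 < r k := fun k => by positivity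
  have hrx : ∀ k, ‖r k • x k‖ ≤ (1 / 2) ^ k := fun k => by
    rw [norm_smul, Real.norm_eq_abs, abs_of_pos (hr k), div_mul_eq_mul_div]
    exact div_le_of_le_mul₀ (by positivity) (by positivity)
      (by gcongr; linarith)
  have hbd : ∀ (a : lp (fun _ : ℕ => ℝ) 2) k, ‖a k • r k • x k‖ ≤ ‖a‖ * (1 / 2) ^ k := fun a k => by
    rw [norm_smul]
    exact mul_le_mul (lp.norm_apply_le_norm two_ne_zero a k) (hrx k) (norm_nonneg _)
      (norm_nonneg _)
  have hgeo : ∀ a : lp (fun _ : ℕ => ℝ) 2, HasSum (fun k : ℕ => ‖a‖ * (1 / 2) ^ k) (‖a‖ * 2) :=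
    fun a => hasSum_geometric_two.mul_left _
  have hsum : ∀ a : lp (fun _ : ℕ => ℝ) 2, Summable fun k => a k • r k • x k := fun a =>
    Summable.of_norm_bounded (hgeo a).summable (hbd a)
  let L₀ : lp (fun _ : ℕ => ℝ) 2 →ₗ[ℝ] X :=
    { toFun := fun a => ∑' k, a k • r k • x k
      map_add' := fun a b => by
        rw [← (hsum a).tsum_add (hsum b)]
        simp only [lp.coeFn_add, Pi.add_apply, add_smul]
      map_smul' := fun c a => by
        rw [RingHom.id_apply, ← (hsum a).tsum_const_smul c]
        simp only [lp.coeFn_smul, Pi.smul_apply, smul_eq_mul, mul_smul] }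
  let L := L₀.mkContinuous 2 fun a => by
    rw [mul_comm]
    exact tsum_of_norm_bounded (hgeo a) (hbd a)
  refine ⟨L, (TopologicalSpace.denseRange_denseSeq X).mono ?_⟩
  rintro _ ⟨k, rfl⟩
  refine ⟨(r k)⁻¹ • lp.single 2 k (1 : ℝ), ?_⟩
  rw [map_smul]
  have : L (lp.single 2 k (1 : ℝ)) = r k • x k := by
    change ∑' j, (lp.single 2 k (1 : ℝ) : ∀ _, ℝ) j • r j • x j = _
    rw [tsum_eq_single k]
    · simp
    · intro j hj
      simp [hj]
  rw [this, inv_smul_smul₀ (hr k).ne']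

theorem exists_gateauxSmooth_equivalentNorm (X : Type*) [NormedAddCommGroup X] [NormedSpace ℝ X]
    [CompleteSpace X] [TopologicalSpace.SeparableSpace X] :
    ∃ q : Seminorm ℝ X, IsEquivalentNorm q ∧ IsGateauxSmooth q := by
  obtain ⟨L, hL⟩ := exists_denseRange_lp_two X
  exact ⟨infConvNorm L, isEquivalentNorm_infConvNorm L, isGateauxSmooth_infConvNorm L hL⟩

end SmoothNorm

/-! ### Adding kinks to a smooth norm, and how isometries act on them -/

section FeatureNorm

variable {X : Type*} [NormedAddCommGroup X] [NormedSpace ℝ X] {ι : Type*}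

theorem summable_abs_apply {φ : ι → StrongDual ℝ X} (hφ : Summable fun i => ‖φ i‖) (x : X) :
    Summable fun i => |φ i x| :=
  Summable.of_nonneg_of_le (fun _ => abs_nonneg _) (fun i => (φ i).le_opNorm x)
    (hφ.mul_right ‖x‖)

/-- The seminorm `x ↦ Q x + ∑ i, |φ i x|`. -/
noncomputable def addAbsSum (Q : Seminorm ℝ X) (φ : ι → StrongDual ℝ X)
    (hφ : Summable fun i => ‖φ i‖) : Seminorm ℝ X :=
  Seminorm.of (fun x => Q x + ∑' i, |φ i x|)
    (fun x y => by
      have h : ∑' i, |φ i (x + y)| ≤ ∑' i, |φ i x| + ∑' i, |φ i y| := by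
        rw [← (summable_abs_apply hφ x).tsum_add (summable_abs_apply hφ y)]
        refine (summable_abs_apply hφ _).tsum_le_tsum (fun i => ?_)
          ((summable_abs_apply hφ x).add (summable_abs_apply hφ y))
        rw [map_add]
        exact abs_add_le _ _
      have := map_add_le_add Q x y
      linarith)
    (fun r x => by
      simp only [map_smul_eq_mul, map_smul, smul_eq_mul, abs_mul, tsum_mul_left, Real.norm_eq_abs]
      ring)

variable {Q : Seminorm ℝ X} {φ : ι → StrongDual ℝ X} {hφ : Summable fun i => ‖φ i‖}

theorem addAbsSum_apply (x : X) : addAbsSum Q φ hφ x = Q x + ∑' i, |φ i x| := rfl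

theorem addAbsSum_le {C : ℝ} (hC : ∀ x, Q x ≤ C * ‖x‖) (x : X) :
    addAbsSum Q φ hφ x ≤ (C + ∑' i, ‖φ i‖) * ‖x‖ := by
  rw [addAbsSum_apply, add_mul, ← tsum_mul_right]
  exact add_le_add (hC x) ((summable_abs_apply hφ x).tsum_le_tsum
    (fun i => (φ i).le_opNorm x) (hφ.mul_right _))

theorem le_addAbsSum (x : X) : Q x ≤ addAbsSum Q φ hφ x :=
  le_add_of_nonneg_right (tsum_nonneg fun _ => abs_nonneg _)

theorem isEquivalentNorm_addAbsSum (hQ : IsEquivalentNorm Q) :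
    IsEquivalentNorm (addAbsSum Q φ hφ) := by
  obtain ⟨c, C, hc, hC, h⟩ := hQ
  exact ⟨c, C + ∑' i, ‖φ i‖, hc, add_pos_of_pos_of_nonneg hC (tsum_nonneg fun _ => norm_nonneg _),
    fun x => ⟨(h x).1.trans (le_addAbsSum x), addAbsSum_le (fun x => (h x).2) x⟩⟩

theorem abs_second_difference_le (a b : ℝ) : |(|a + b| + |a - b| - 2 * |a|)| ≤ 2 * |b| := by
  have h1 := abs_add_le a b
  have h2 := abs_sub a b
  have h3 := abs_add_le (a + b) (a - b)
  rw [show a + b + (a - b) = 2 * a by ring, abs_mul, abs_two] at h3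
  rw [abs_le]
  constructor <;> linarith [abs_nonneg b]

-- The absolute value is affine near `a ≠ 0`, so the quotient is eventually zero; at `a = 0` it is
-- constant in `t`.
open Classical in
theorem tendsto_abs_second_difference (a b : ℝ) :
    Tendsto (fun t : ℝ => (|a + t * b| + |a - t * b| - 2 * |a|) / t) (𝓝[>] 0)
      (𝓝 (if a = 0 then 2 * |b| else 0)) := by
  refine tendsto_const_nhds.congr' ?_
  split_ifs with ha
  · filter_upwards [self_mem_nhdsWithin] with t ht
    have ht : 0 < t := ht
    simp only [ha, zero_add, zero_sub, abs_neg, abs_mul, abs_of_pos ht, abs_zero]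
    field_simp
    ring
  · have hlim : Tendsto (fun t : ℝ => |t * b|) (𝓝[>] 0) (𝓝 0) := by
      refine tendsto_nhdsWithin_of_tendsto_nhds ?_
      have : Continuous fun t : ℝ => |t * b| := by fun_prop
      simpa using this.tendsto 0
    filter_upwards [hlim.eventually_lt_const (abs_pos.2 ha)] with t ht
    have : |a + t * b| + |a - t * b| - 2 * |a| = 0 := by
      obtain ⟨h1, h2⟩ := abs_lt.1 ht
      rcases lt_or_gt_of_ne ha with h | h
      · rw [abs_of_neg h] at h1 h2 ⊢
        rw [abs_of_neg (by linarith), abs_of_neg (by linarith)]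
        ring
      · rw [abs_of_pos h] at h1 h2 ⊢
        rw [abs_of_pos (by linarith), abs_of_pos (by linarith)]
        ring
    rw [this, zero_div]

open Classical in
/-- The second difference quotients of `addAbsSum Q φ` at `x` only see the functionals that vanish
at `x`. -/
theorem tendsto_second_difference_addAbsSum (hQ : IsGateauxSmooth Q) {x : X} (hx : x ≠ 0) (h : X) :
    Tendsto (fun t : ℝ => (addAbsSum Q φ hφ (x + t • h) + addAbsSum Q φ hφ (x - t • h)
        - 2 * addAbsSum Q φ hφ x) / t) (𝓝[>] 0)
      (𝓝 (∑' i, if φ i x = 0 then 2 * |φ i h| else 0)) := by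
  have h1 : Tendsto (fun t : ℝ => ∑' i, (|φ i x + t * φ i h| + |φ i x - t * φ i h| - 2 * |φ i x|) / t)
      (𝓝[>] 0) (𝓝 (∑' i, if φ i x = 0 then 2 * |φ i h| else 0)) := by
    refine tendsto_tsum_of_dominated_convergence ((summable_abs_apply hφ h).mul_left 2)
      (fun i => tendsto_abs_second_difference _ _) ?_
    filter_upwards [self_mem_nhdsWithin] with t ht i
    have ht : 0 < t := ht
    rw [Real.norm_eq_abs, abs_div, abs_of_pos ht, div_le_iff₀ ht]
    refine (abs_second_difference_le _ _).trans_eq ?_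
    rw [abs_mul, abs_of_pos ht]
    ring
  have h2 := (hQ x hx h).add h1
  rw [zero_add] at h2
  refine h2.congr fun t => ?_
  have s1 := summable_abs_apply hφ (x + t • h)
  have s2 := summable_abs_apply hφ (x - t • h)
  have s3 := (summable_abs_apply hφ x).mul_left 2
  have e := ((s1.hasSum.add s2.hasSum).sub s3.hasSum).tsum_eq
  simp only [map_add, map_sub, map_smul, smul_eq_mul, tsum_mul_left] at e
  rw [tsum_div_const, e]
  simp only [addAbsSum_apply, map_add, map_sub, map_smul, smul_eq_mul]
  ring

/-- Countably many pairwise non-proportional functionals: some point is in the kernel of precisely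
one prescribed functional among them. -/
theorem exists_apply_eq_zero_iff [CompleteSpace X] [Countable ι]
    (hprop : ∀ i j, i ≠ j → ∃ x, φ i x = 0 ∧ φ j x ≠ 0) (i : ι) :
    ∃ x, ∀ j, φ j x = 0 ↔ j = i := by
  have hcl : IsClosed ((LinearMap.ker (φ i : X →ₗ[ℝ] ℝ) : Submodule ℝ X) : Set X) :=
    (φ i).isClosed_ker
  have : CompleteSpace (LinearMap.ker (φ i : X →ₗ[ℝ] ℝ)) := hcl.completeSpace_coe
  -- Baire's theorem in the hyperplane `ker (φ i)`: each other functional is nonzero on an open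
  -- dense subset of it.
  have hd : Dense (⋂ j : {j // j ≠ i}, {x : LinearMap.ker (φ i : X →ₗ[ℝ] ℝ) | φ j x ≠ 0}) := by
    refine dense_iInter_of_isOpen (fun j => ?_) fun j => ?_
    · exact isOpen_ne_fun (by fun_prop) continuous_const
    · obtain ⟨y, hy, hy'⟩ := hprop i j j.2.symm
      intro x
      by_cases hx : φ j x = 0
      · let Y : LinearMap.ker (φ i : X →ₗ[ℝ] ℝ) := ⟨y, hy⟩
        have hlim : Tendsto (fun t : ℝ => x + t • Y) (𝓝[>] 0) (𝓝 x) := by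
          refine tendsto_nhdsWithin_of_tendsto_nhds ?_
          have : Continuous fun t : ℝ => x + t • Y := by fun_prop
          simpa using this.tendsto 0
        refine mem_closure_of_tendsto hlim ?_
        filter_upwards [self_mem_nhdsWithin] with t ht
        have ht : 0 < t := ht
        simp [hx, Y, hy', ht.ne']
      · exact subset_closure hx
  obtain ⟨x, hx⟩ := hd.nonempty
  refine ⟨x, fun j => ⟨fun h => ?_, ?_⟩⟩
  · by_contra hj
    exact Set.mem_iInter.1 hx ⟨j, hj⟩ h
  · rintro rfl
    exact x.2

/-- Equal kernels make the two functionals proportional, and one nonzero value fixes the factor as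
`± 1`. -/
theorem LinearMap.eq_or_eq_neg_of_abs_eq {V : Type*} [AddCommGroup V] [Module ℝ V]
    {f g : V →ₗ[ℝ] ℝ} (h : ∀ x, |f x| = |g x|) : f = g ∨ f = -g := by
  by_cases hf : f = 0
  · left
    ext x
    have := h x
    rw [hf, LinearMap.zero_apply, abs_zero, eq_comm, abs_eq_zero] at this
    rw [hf, this, LinearMap.zero_apply]
  · obtain ⟨y, hy⟩ : ∃ y, f y ≠ 0 := by
      by_contra! hcon
      exact hf (LinearMap.ext hcon)
    have hgf : ∀ x, g x = f x / f y * g y := fun x => by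
      have h1 := h (x - (f x / f y) • y)
      rw [map_sub, map_smul, smul_eq_mul, div_mul_cancel₀ _ hy, sub_self, abs_zero, eq_comm,
        abs_eq_zero, map_sub, map_smul, smul_eq_mul, sub_eq_zero] at h1
      exact h1
    rcases abs_eq_abs.1 (h y) with h1 | h1
    · left
      ext x
      rw [hgf x, ← h1, div_mul_cancel₀ _ hy]
    · right
      ext x
      rw [LinearMap.neg_apply, hgf x, show g y = -f y by linarith, mul_neg, neg_neg,
        div_mul_cancel₀ _ hy]

/-- A linear isometry of `addAbsSum Q φ` permutes the functionals `φ i` up to sign. -/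
theorem exists_apply_isometry_eq [CompleteSpace X] [Countable ι] [Nontrivial ι]
    (hQ : IsGateauxSmooth Q) (hprop : ∀ i j, i ≠ j → ∃ x, φ i x = 0 ∧ φ j x ≠ 0)
    {T : X ≃ₗ[ℝ] X} (hT : T ∈ isometryGroup (addAbsSum Q φ hφ)) (i : ι) :
    ∃ j, ∃ ε : ℝ, (ε = 1 ∨ ε = -1) ∧ ∀ x, φ i (T x) = ε * φ j x := by
  classical
  have hT : ∀ x, addAbsSum Q φ hφ (T x) = addAbsSum Q φ hφ x := hT
  have hne : ∀ j, ∃ x, φ j x ≠ 0 := fun j => by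
    obtain ⟨k, hk⟩ := exists_ne j
    exact (hprop k j hk).imp fun _ h => h.2
  obtain ⟨x, hx⟩ := exists_apply_eq_zero_iff hprop i
  obtain ⟨y, rfl⟩ := T.surjective x
  have hTy : T y ≠ 0 := fun h => by
    obtain ⟨k, hk⟩ := exists_ne i
    exact hk ((hx k).1 (by rw [h, map_zero]))
  have hy : y ≠ 0 := fun h => hTy (by rw [h, map_zero])
  -- The second difference limits at `T y` and at `y` agree. Only `φ i` vanishes at `T y`, so one
  -- side is a single term.
  have key : ∀ h, |φ i (T h)| = ∑' j, if φ j y = 0 then |φ j h| else 0 := fun h => by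
    have h1 := tendsto_second_difference_addAbsSum (hφ := hφ) hQ hTy (T h)
    simp only [← map_smul, ← map_add T, ← map_sub T, hT] at h1
    have h2 := tendsto_nhds_unique h1 (tendsto_second_difference_addAbsSum (hφ := hφ) hQ hy h)
    simp only [hx, tsum_ite_eq] at h2
    have h3 : ∀ j, (if φ j y = 0 then 2 * |φ j h| else 0)
        = 2 * (if φ j y = 0 then |φ j h| else 0) := fun j => by split_ifs <;> simp
    simp only [h3, tsum_mul_left] at h2
    linarith
  have hs : ∀ h, Summable fun j => if φ j y = 0 then |φ j h| else 0 := fun h =>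
    (summable_abs_apply hφ h).of_nonneg_of_le (fun j => by split_ifs <;> positivity)
      (fun j => by split_ifs <;> simp)
  have hle : ∀ j, φ j y = 0 → ∀ h, |φ j h| ≤ |φ i (T h)| := fun j hj h => by
    rw [key h]
    refine le_of_eq_of_le ?_ ((hs h).le_tsum j fun k _ => by split_ifs <;> positivity)
    rw [if_pos hj]
  obtain ⟨j, hj⟩ : ∃ j, φ j y = 0 := by
    by_contra! hcon
    obtain ⟨z, hz⟩ := hne i
    obtain ⟨w, rfl⟩ := T.surjective z
    have := key w
    simp only [hcon, if_false, tsum_zero, abs_eq_zero] at this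
    exact hz this
  -- By `hle`, every functional vanishing at `y` vanishes on the hyperplane `ker (φ i ∘ T)`; two of
  -- them would be proportional.
  have huniq : ∀ k, φ k y = 0 ↔ k = j := fun k => by
    refine ⟨fun hk => ?_, fun h => h ▸ hj⟩
    by_contra hkj
    obtain ⟨z, hz, hz'⟩ := hprop k j hkj
    have hTz : φ i (T z) ≠ 0 := fun h0 => hz' (by
      have := hle j hj z
      rwa [h0, abs_zero, abs_nonpos_iff] at this)
    obtain ⟨w, hw⟩ := hne k
    have h1 := hle k hk (w - (φ i (T w) / φ i (T z)) • z)
    rw [map_sub, map_sub T, map_smul, map_smul, map_sub, map_smul, hz, smul_zero, sub_zero,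
      smul_eq_mul, div_mul_cancel₀ _ hTz, sub_self, abs_zero, abs_nonpos_iff] at h1
    exact hw h1
  have habs : ∀ h, |((φ i : X →ₗ[ℝ] ℝ) ∘ₗ (T : X →ₗ[ℝ] X)) h| = |(φ j : X →ₗ[ℝ] ℝ) h| :=
    fun h => by
      have := key h
      simp only [huniq, tsum_ite_eq] at this
      exact this
  rcases LinearMap.eq_or_eq_neg_of_abs_eq habs with h | h
  · exact ⟨j, 1, Or.inl rfl, fun x => by simpa using LinearMap.congr_fun h x⟩
  · exact ⟨j, -1, Or.inr rfl, fun x => by simpa using LinearMap.congr_fun h x⟩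

/-- If `φ i` is sent to `± φ j` by an isometry of an equivalent norm then the norms of the two
functionals are comparable. -/
theorem norm_le_of_apply_isometry_eq {p : Seminorm ℝ X} {c C : ℝ} (hc : 0 < c)
    (hp : ∀ x, c * ‖x‖ ≤ p x ∧ p x ≤ C * ‖x‖) (hC : 0 ≤ C) {f g : StrongDual ℝ X}
    {T : X ≃ₗ[ℝ] X} (hT : T ∈ isometryGroup p) {ε : ℝ} (hε : ε = 1 ∨ ε = -1)
    (h : ∀ x, f (T x) = ε * g x) : ‖f‖ ≤ C / c * ‖g‖ ∧ ‖g‖ ≤ C / c * ‖f‖ := by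
  have hT : ∀ x, p (T x) = p x := hT
  have habs : ∀ x, |f (T x)| = |g x| := fun x => by
    rw [h, abs_mul]
    rcases hε with rfl | rfl <;> simp
  have hle : ∀ x y, p x = p y → ‖x‖ ≤ C / c * ‖y‖ := fun x y hxy => by
    rw [div_mul_eq_mul_div, le_div_iff₀ hc]
    linarith [(hp x).1, (hp y).2]
  constructor
  · refine f.opNorm_le_bound (by positivity) fun x => ?_
    obtain ⟨y, rfl⟩ := T.surjective x
    rw [Real.norm_eq_abs, habs]
    refine (g.le_opNorm y).trans ?_
    have := mul_le_mul_of_nonneg_left (hle y (T y) (hT y).symm) (norm_nonneg g)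
    linarith
  · refine g.opNorm_le_bound (by positivity) fun x => ?_
    rw [Real.norm_eq_abs, ← habs]
    refine (f.le_opNorm (T x)).trans ?_
    have := mul_le_mul_of_nonneg_left (hle (T x) x (hT x)) (norm_nonneg f)
    linarith

end FeatureNorm

/-! ### Rapidly decreasing weights -/

/-- Weights, constant on the fibres of `cl`, that make the values `w (cl i) * a i` summable and
decrease rapidly from one fibre to the next. -/
theorem exists_weights {ι : Type*} [Countable ι] (cl : ι → ℕ) (hcl : ∀ m, (cl ⁻¹' {m}).Finite)
    (a : ι → ℝ) (ha : ∀ i, 0 < a i) {κ : ℝ} (hκ : 0 < κ) :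
    ∃ w : ℕ → ℝ, (∀ m, 0 < w m) ∧ (Summable fun i => w (cl i) * a i) ∧
      ∑' i, w (cl i) * a i ≤ 1 ∧
      ∀ i j, cl i < cl j → w (cl j) * a j < κ * (w (cl i) * a i) := by
  classical
  have := Encodable.ofCountable ι
  -- The first summand yields domination by a geometric series of sum at most `1`; the second bounds
  -- `a i` below by `(A (cl i))⁻¹`.
  set b : ι → ℝ := fun i => a i * 2 ^ (Encodable.encode i + 1) + (a i)⁻¹ with hb
  have hbpos : ∀ i, 0 < b i := fun i => by have := ha i; positivity
  set A : ℕ → ℝ := fun m => 1 + ∑ i ∈ (hcl m).toFinset, b i with hA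
  have hA1 : ∀ m, 1 ≤ A m := fun m =>
    le_add_of_nonneg_right (Finset.sum_nonneg fun i _ => (hbpos i).le)
  have hbA : ∀ i, b i ≤ A (cl i) := fun i => by
    have := Finset.single_le_sum (f := b) (fun i _ => (hbpos i).le)
      (show i ∈ (hcl (cl i)).toFinset by simp)
    linarith
  set r : ℝ := min κ 1 / 2 with hr
  have hr0 : 0 < r := by positivity
  have hr1 : r ≤ 1 := by linarith [min_le_right κ 1]
  have hrκ : r < κ := by linarith [min_le_left κ 1]
  -- With weight `d m / A m`, values in class `m` are at most `d m` and at least `d m / A m ^ 2`, so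
  -- this factor makes the next class smaller by `r < κ`.
  set d : ℕ → ℝ := fun m => ∏ k ∈ Finset.range m, r / A k ^ 2 with hd
  have hdpos : ∀ m, 0 < d m := fun m =>
    Finset.prod_pos fun k _ => div_pos hr0 (pow_pos (by linarith [hA1 k]) _)
  have hdsucc : ∀ m, d (m + 1) = d m * (r / A m ^ 2) := fun m => Finset.prod_range_succ _ _
  have hdanti : Antitone d := antitone_nat_of_succ_le fun m => by
    rw [hdsucc]
    refine mul_le_of_le_one_right (hdpos m).le (div_le_one_of_le₀ ?_ (by positivity))
    exact hr1.trans (one_le_pow₀ (hA1 m))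
  have hd1 : ∀ m, d m ≤ 1 := fun m => by
    simpa [hd] using hdanti (Nat.zero_le m)
  have hupper : ∀ i, d (cl i) / A (cl i) * a i ≤ d (cl i) * (1 / 2) ^ (Encodable.encode i + 1) :=
    fun i => by
      have h1 : a i * 2 ^ (Encodable.encode i + 1) ≤ A (cl i) :=
        (le_add_of_nonneg_right (inv_nonneg.2 (ha i).le)).trans (hbA i)
      rw [div_mul_eq_mul_div, div_le_iff₀ (by linarith [hA1 (cl i)]), mul_assoc]
      refine mul_le_mul_of_nonneg_left ?_ (hdpos _).le
      rw [one_div, inv_pow, inv_mul_eq_div, le_div_iff₀ (by positivity)]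
      exact h1
  have hgeo : ∀ i, d (cl i) / A (cl i) * a i ≤ (1 / 2) ^ (Encodable.encode i + 1) := fun i =>
    (hupper i).trans (mul_le_of_le_one_left (by positivity) (hd1 _))
  have hnn : ∀ i, 0 ≤ d (cl i) / A (cl i) * a i := fun i =>
    mul_nonneg (div_nonneg (hdpos _).le (by linarith [hA1 (cl i)])) (ha i).le
  have hgs : Summable fun n : ℕ => (1 / 2 : ℝ) ^ (n + 1) := by
    simpa only [pow_succ] using summable_geometric_two.mul_right (1 / 2 : ℝ)
  have hgt : ∑' n : ℕ, (1 / 2 : ℝ) ^ (n + 1) = 1 := by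
    simp only [pow_succ, tsum_mul_right, tsum_geometric_two]
    norm_num
  have hes : Summable fun i : ι => (1 / 2 : ℝ) ^ (Encodable.encode i + 1) :=
    hgs.comp_injective Encodable.encode_injective
  have hsum := Summable.of_nonneg_of_le hnn hgeo hes
  refine ⟨fun m => d m / A m, fun m => div_pos (hdpos m) (by linarith [hA1 m]), hsum, ?_, ?_⟩
  · refine (hsum.tsum_le_tsum hgeo hes).trans (le_of_le_of_eq ?_ hgt)
    exact hes.tsum_le_tsum_of_inj Encodable.encode Encodable.encode_injective
      (fun _ _ => by positivity) (fun _ => le_rfl) hgs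
  · intro i j hij
    have hAi : 0 < A (cl i) := by linarith [hA1 (cl i)]
    have h1 : d (cl j) / A (cl j) * a j ≤ d (cl j) :=
      (hupper j).trans (mul_le_of_le_one_right (hdpos _).le
        (pow_le_one₀ (by norm_num) (by norm_num)))
    have h2 : d (cl j) ≤ d (cl i + 1) := hdanti hij
    rw [hdsucc] at h2
    have h3 : (A (cl i))⁻¹ ≤ a i := by
      rw [inv_le_comm₀ hAi (ha i)]
      exact (le_add_of_nonneg_left (by have := ha i; positivity)).trans (hbA i)
    calc _ ≤ d (cl i) * (r / A (cl i) ^ 2) := h1.trans h2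
      _ = r * (d (cl i) / A (cl i) * (A (cl i))⁻¹) := by field_simp
      _ ≤ r * (d (cl i) / A (cl i) * a i) := by
        have := hdpos (cl i)
        gcongr
      _ < κ * (d (cl i) / A (cl i) * a i) := by
        have := hdpos (cl i)
        have := ha i
        gcongr

/-! ### Biorthogonal systems and total families of functionals -/

section BiorthogonalSystem

variable {X : Type*} [NormedAddCommGroup X] [NormedSpace ℝ X]

/-- By Hahn–Banach, every functional on the span of the finite family is the restriction of a
continuous one. -/
theorem LinearIndependent.exists_biorthogonal {ι : Type*} [Fintype ι] [DecidableEq ι] {u : ι → X}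
    (hu : LinearIndependent ℝ u) :
    ∃ e : ι → StrongDual ℝ X, ∀ i j, e i (u j) = if i = j then 1 else 0 := by
  have hinj : Function.Injective (Fintype.linearCombination ℝ u) :=
    linearIndependent_iff_injective_fintypeLinearCombination.1 hu
  have hsurj := SeparatingDual.dualMap_surjective_iff.2 hinj
  choose e he using fun i => hsurj (LinearMap.proj i)
  refine ⟨e, fun i j => ?_⟩
  have := LinearMap.congr_fun (he i) (Pi.single j 1)
  simpa [Fintype.linearCombination_apply_single, Pi.single_apply, eq_comm] using this

/-- Norming functionals of a dense sequence suffice: if all vanish at `x`, a dense point `y` near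
`x` has `‖y‖ = f k (y - x) ≤ ‖x - y‖`, so `x` is arbitrarily small. -/
theorem exists_total_sequence (X : Type*) [NormedAddCommGroup X] [NormedSpace ℝ X]
    [TopologicalSpace.SeparableSpace X] :
    ∃ f : ℕ → StrongDual ℝ X, ∀ x, (∀ k, f k x = 0) → x = 0 := by
  choose f hf1 hf using fun k => exists_dual_vector'' ℝ (TopologicalSpace.denseSeq X k)
  refine ⟨f, fun x hx => ?_⟩
  rw [← norm_le_zero_iff]
  refine le_of_forall_pos_le_add fun ε hε => ?_
  obtain ⟨k, hk⟩ := (TopologicalSpace.denseRange_denseSeq X).exists_dist_lt x (half_pos hε)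
  set y := TopologicalSpace.denseSeq X k
  rw [dist_eq_norm] at hk
  have h1 : ‖y‖ ≤ ‖x - y‖ := by
    have h2 : f k (y - x) = ‖y‖ := by
      rw [map_sub, hx, sub_zero]
      exact hf k
    rw [← h2, norm_sub_rev]
    exact (le_abs_self _).trans (((f k).le_opNorm _).trans
      (mul_le_of_le_one_left (norm_nonneg _) (hf1 k)))
  have h3 := norm_add_le (x - y) y
  rw [sub_add_cancel] at h3
  linarith

/-- A finite biorthogonal system extends to a total system of functionals that, in a strong sense,
is pairwise independent. -/
theorem exists_total_extension [TopologicalSpace.SeparableSpace X] {ι : Type*} [Fintype ι]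
    [DecidableEq ι] {u : ι → X} {e : ι → StrongDual ℝ X}
    (he : ∀ i j, e i (u j) = if i = j then 1 else 0) :
    ∃ K : Set (StrongDual ℝ X), K.Countable ∧ (∀ ψ ∈ K, ∀ i, ψ (u i) = 0) ∧
      (∀ x, (∀ i, e i x = 0) → (∀ ψ ∈ K, ψ x = 0) → x = 0) ∧
      (∀ ψ ∈ K, ∃ z, (∀ i, e i z = 0) ∧ ψ z ≠ 0) ∧
      (∀ ψ ∈ K, ∀ ψ' ∈ K, ψ ≠ ψ' → ∃ z, (∀ i, e i z = 0) ∧ ψ z = 0 ∧ ψ' z ≠ 0) := by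
  obtain ⟨f, hf⟩ := exists_total_sequence X
  set F : ℕ → StrongDual ℝ X := fun k => f k - ∑ i, f k (u i) • e i with hF
  have hFu : ∀ k j, F k (u j) = 0 := fun k j => by simp [hF, he]
  have hFe : ∀ k x, (∀ i, e i x = 0) → F k x = f k x := fun k x hx => by simp [hF, hx]
  -- Keeping the span preserves totality, while linear independence excludes proportional pairs.
  obtain ⟨K, hKsub, hKspan, hK⟩ := exists_linearIndependent ℝ (Set.range F)
  have hKu : ∀ ψ ∈ K, ∀ i, ψ (u i) = 0 := fun ψ hψ i => by
    obtain ⟨k, rfl⟩ := hKsub hψ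
    exact hFu k i
  -- Projection along the `u i` moves any test vector into the common kernel of the `e i` without
  -- changing values of `ψ ∈ K`.
  have hproj : ∀ z, ∃ z', (∀ i, e i z' = 0) ∧ ∀ ψ ∈ K, ψ z' = ψ z := fun z =>
    ⟨z - ∑ i, e i z • u i, fun i => by simp [he], fun ψ hψ => by simp [hKu ψ hψ]⟩
  refine ⟨K, (Set.countable_range F).mono hKsub, hKu, fun x hx hxK => hf x fun k => ?_, ?_, ?_⟩
  · rw [← hFe k x hx]
    have hmem : F k ∈ Submodule.span ℝ K := hKspan ▸ Submodule.subset_span ⟨k, rfl⟩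
    generalize F k = φ at hmem
    induction hmem using Submodule.span_induction with
    | mem ψ hψ => exact hxK ψ hψ
    | zero => rfl
    | add a b _ _ ha hb => rw [add_apply, ha, hb, add_zero]
    | smul r a _ ha => rw [smul_apply, ha, smul_zero]
  · intro ψ hψ
    obtain ⟨z, hz⟩ : ∃ z, ψ z ≠ 0 := by
      by_contra! hcon
      exact hK.ne_zero ⟨ψ, hψ⟩ (ContinuousLinearMap.ext hcon)
    obtain ⟨z', h1, h2⟩ := hproj z
    exact ⟨z', h1, by rwa [h2 ψ hψ]⟩
  · intro ψ hψ ψ' hψ' hne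
    obtain ⟨z, hz, hz'⟩ : ∃ z, ψ z = 0 ∧ ψ' z ≠ 0 := by
      by_contra! hcon
      have hnot := hK.notMem_span_image (s := {⟨ψ, hψ⟩}) (x := ⟨ψ', hψ'⟩)
        (fun h => hne (congrArg Subtype.val (Set.mem_singleton_iff.1 h)).symm)
      rw [Set.image_singleton] at hnot
      obtain ⟨y, hy⟩ : ∃ y, ψ y ≠ 0 := by
        by_contra! hcon'
        exact hK.ne_zero ⟨ψ, hψ⟩ (ContinuousLinearMap.ext hcon')
      refine hnot (Submodule.mem_span_singleton.2 ⟨ψ' y / ψ y, ContinuousLinearMap.ext fun x => ?_⟩)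
      have h1 := hcon (x - (ψ x / ψ y) • y) (by
        rw [map_sub, map_smul, smul_eq_mul, div_mul_cancel₀ _ hy, sub_self])
      rw [map_sub, map_smul, sub_eq_zero, smul_eq_mul] at h1
      rw [smul_apply, h1, smul_eq_mul]
      ring
    obtain ⟨z', h1, h2⟩ := hproj z
    exact ⟨z', h1, by rwa [h2 ψ hψ], by rwa [h2 ψ' hψ']⟩

end BiorthogonalSystem

/-! ### The action of signs and `G` on the space, and averaging over `G` -/

section Shift

variable {X : Type*} [NormedAddCommGroup X] [NormedSpace ℝ X] {G : Type*} [Group G] [Fintype G]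

/-- The operator that sends `u h` to `u (g * h)` and fixes the common kernel of the functionals
`e h`, when `u` and `e` are biorthogonal. -/
noncomputable def shift (u : G → X) (e : G → StrongDual ℝ X) (g : G) : X →L[ℝ] X :=
  ContinuousLinearMap.id ℝ X + ∑ h, (e h).smulRight (u (g * h) - u h)

variable {u : G → X} {e : G → StrongDual ℝ X}

theorem shift_apply (g : G) (x : X) :
    shift u e g x = x + ∑ h, e h x • (u (g * h) - u h) := by
  simp [shift]

theorem shift_one (x : X) : shift u e 1 x = x := by simp [shift_apply]

theorem apply_shift {f : StrongDual ℝ X} (hf : ∀ h, f (u h) = 0) (g : G) (x : X) :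
    f (shift u e g x) = f x := by
  simp [shift_apply, hf]

/-- The average of a seminorm over the shifts. -/
noncomputable def shiftAverage (u : G → X) (e : G → StrongDual ℝ X) (q : Seminorm ℝ X) :
    Seminorm ℝ X :=
  Seminorm.of (fun x => ∑ g, q (shift u e g x))
    (fun x y => by
      rw [← Finset.sum_add_distrib]
      refine Finset.sum_le_sum fun g _ => ?_
      rw [map_add (shift u e g)]
      exact map_add_le_add q _ _)
    (fun r x => by
      rw [Finset.mul_sum]
      refine Finset.sum_congr rfl fun g _ => ?_
      rw [map_smul (shift u e g), map_smul_eq_mul])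

variable {q : Seminorm ℝ X}

theorem shiftAverage_apply (x : X) : shiftAverage u e q x = ∑ g, q (shift u e g x) := rfl

theorem isEquivalentNorm_shiftAverage (hq : IsEquivalentNorm q) :
    IsEquivalentNorm (shiftAverage u e q) := by
  obtain ⟨c, C, hc, hC, h⟩ := hq
  refine ⟨c, ∑ g, C * (‖shift u e g‖ + 1), hc,
    Finset.sum_pos (fun g _ => by positivity) Finset.univ_nonempty, fun x => ⟨?_, ?_⟩⟩
  · rw [shiftAverage_apply]
    refine (h x).1.trans ?_
    have := Finset.single_le_sum (f := fun g => q (shift u e g x)) (fun g _ => apply_nonneg q _)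
      (Finset.mem_univ 1)
    rwa [shift_one] at this
  · rw [shiftAverage_apply, Finset.sum_mul]
    refine Finset.sum_le_sum fun g _ => (h _).2.trans ?_
    rw [mul_assoc]
    refine mul_le_mul_of_nonneg_left (((shift u e g).le_opNorm x).trans ?_) hC.le
    exact mul_le_mul_of_nonneg_right (by linarith) (norm_nonneg x)

variable [DecidableEq G]

theorem biorthogonal_shift (he : ∀ i j, e i (u j) = if i = j then 1 else 0) (g h : G) (x : X) :
    e h (shift u e g x) = e (g⁻¹ * h) x := by
  have h1 : ∀ k, (h = g * k) = (k = g⁻¹ * h) := fun k => by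
    rw [eq_iff_iff, eq_comm, ← eq_inv_mul_iff_mul_eq]
  simp [shift_apply, he, mul_sub, h1]

theorem shift_mul (he : ∀ i j, e i (u j) = if i = j then 1 else 0) (g k : G) (x : X) :
    shift u e (g * k) x = shift u e g (shift u e k x) := by
  rw [shift_apply g, shift_apply (g * k)]
  simp only [biorthogonal_shift he]
  rw [← Equiv.sum_comp (Equiv.mulLeft k) fun h => e (k⁻¹ * h) x • (u (g * h) - u h)]
  simp only [Equiv.coe_mulLeft, inv_mul_cancel_left]
  rw [shift_apply k, add_assoc, ← Finset.sum_add_distrib]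
  congr 1
  refine Finset.sum_congr rfl fun h _ => ?_
  rw [← smul_add, mul_assoc]
  congr 1
  abel

theorem shift_apply_basis (he : ∀ i j, e i (u j) = if i = j then 1 else 0) (g h : G) :
    shift u e g (u h) = u (g * h) := by
  simp [shift_apply, he]

/-- The shifts, as a representation of `G` on `X`. -/
noncomputable def shiftHom (he : ∀ i j, e i (u j) = if i = j then 1 else 0) :
    G →* (X ≃ₗ[ℝ] X) where
  toFun g := LinearEquiv.ofLinearMap (shift u e g : X →ₗ[ℝ] X) (shift u e g⁻¹ : X →ₗ[ℝ] X)
    (LinearMap.ext fun x => by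
      simp only [LinearMap.comp_apply, ContinuousLinearMap.coe_coe, LinearMap.id_apply]
      rw [← shift_mul he, mul_inv_cancel, shift_one])
    (LinearMap.ext fun x => by
      simp only [LinearMap.comp_apply, ContinuousLinearMap.coe_coe, LinearMap.id_apply]
      rw [← shift_mul he, inv_mul_cancel, shift_one])
  map_one' := LinearEquiv.ext fun x => shift_one x
  map_mul' g k := LinearEquiv.ext fun x => shift_mul he g k x

/-- The action of `ℤˣ × G` on `X` by signed shifts. -/
noncomputable def signedShiftHom (he : ∀ i j, e i (u j) = if i = j then 1 else 0) :
    ℤˣ × G →* (X ≃ₗ[ℝ] X) :=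
  MonoidHom.noncommCoprod (DistribMulAction.toModuleAut ℝ X) (shiftHom he) fun ε g =>
    LinearEquiv.ext fun x => ((shiftHom he g).map_smul_of_tower ε x).symm

theorem signedShiftHom_apply (he : ∀ i j, e i (u j) = if i = j then 1 else 0) (ε : ℤˣ) (g : G)
    (x : X) : signedShiftHom he (ε, g) x = ε • shift u e g x := rfl

/-- The value of `e 1` at the image of `u 1` is `± 1` or `0`; it equals `1` only for the identity.
-/
theorem injective_signedShiftHom (he : ∀ i j, e i (u j) = if i = j then 1 else 0) :
    Function.Injective (signedShiftHom he) := by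
  rw [injective_iff_map_eq_one]
  rintro ⟨ε, g⟩ h
  have h1 : ε • shift u e g (u 1) = u 1 := LinearEquiv.congr_fun h (u 1)
  rw [shift_apply_basis he, mul_one] at h1
  have h2 := congrArg (e 1) h1
  rcases Int.units_eq_one_or ε with rfl | rfl
  · by_cases hg : g = 1
    · rw [hg]; rfl
    · rw [one_smul, he, he, if_neg (Ne.symm hg), if_pos rfl] at h2
      exact absurd h2 zero_ne_one
  · rw [Units.neg_smul, one_smul, map_neg, he, he, if_pos rfl] at h2
    split_ifs at h2 <;> norm_num at h2

theorem shiftAverage_shift (he : ∀ i j, e i (u j) = if i = j then 1 else 0) (g : G) (x : X) :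
    shiftAverage u e q (shift u e g x) = shiftAverage u e q x := by
  simp only [shiftAverage_apply, ← shift_mul he]
  exact Equiv.sum_comp (Equiv.mulRight g) fun h => q (shift u e h x)

theorem isGateauxSmooth_shiftAverage (he : ∀ i j, e i (u j) = if i = j then 1 else 0)
    (hq : IsGateauxSmooth q) : IsGateauxSmooth (shiftAverage u e q) := by
  intro x hx h
  have h1 := tendsto_finsetSum Finset.univ fun g _ =>
    hq (shift u e g x) (fun h0 => hx ((shiftHom he g).map_eq_zero_iff.1 h0)) (shift u e g h)
  rw [Finset.sum_const_zero] at h1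
  refine h1.congr fun t => ?_
  simp only [shiftAverage_apply, map_add (shift u e _), map_sub (shift u e _), map_smul]
  rw [← Finset.sum_div, Finset.mul_sum, ← Finset.sum_add_distrib, ← Finset.sum_sub_distrib]

end Shift

/-! ### The functionals that rigidify the action -/

section Features

variable {X : Type*} [NormedAddCommGroup X] [NormedSpace ℝ X] {G : Type*} [Group G] [Fintype G]
  {K : Type*}

/-- Index set of the functionals that rigidify the action of `G`. The second summand is empty for
trivial `G`. -/
abbrev FeatureIndex (G K : Type*) := (G ⊕ {_g : G // Nontrivial G}) ⊕ (K ⊕ K)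

/-- An injective positive function on a finite type. -/
noncomputable def distinctWeight (g : G) : ℝ := (Fintype.equivFin G g : ℕ) + 1

omit [Group G] in
theorem distinctWeight_pos (g : G) : 0 < distinctWeight g := by
  unfold distinctWeight
  positivity

omit [Group G] in
theorem distinctWeight_injective : Function.Injective (distinctWeight : G → ℝ) := fun g h hgh => by
  simpa [distinctWeight, Fin.val_inj] using hgh

/-- The functionals that rigidify the action of `G`: the coordinates `e g`, the translates of a
generic combination of them, and the functionals `ψ k`, alone and shifted by `∑ h, e h`. -/
noncomputable def feature (e : G → StrongDual ℝ X) (ψ : K → StrongDual ℝ X) :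
    FeatureIndex G K → StrongDual ℝ X
  | .inl (.inl g) => e g
  | .inl (.inr g) => ∑ h, distinctWeight ((g : G)⁻¹ * h) • e h
  | .inr (.inl k) => ψ k
  | .inr (.inr k) => ∑ h, e h + ψ k

variable {e : G → StrongDual ℝ X} {ψ : K → StrongDual ℝ X} {u : G → X}

theorem feature_coord (g : G) (x : X) :
    feature e ψ (.inl (.inl g)) x = e g x := rfl

theorem feature_generic (g : {_g : G // Nontrivial G}) (x : X) :
    feature e ψ (.inl (.inr g)) x = ∑ h, distinctWeight ((g : G)⁻¹ * h) * e h x := by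
  simp [feature]

theorem feature_fixed (k : K) (x : X) : feature e ψ (.inr (.inl k)) x = ψ k x := rfl

theorem feature_sum_add (k : K) (x : X) :
    feature e ψ (.inr (.inr k)) x = ∑ h, e h x + ψ k x := by
  simp [feature]

/-- The kind of a feature. -/
def featureClass [Encodable K] : FeatureIndex G K → ℕ
  | .inl (.inl _) => 0
  | .inl (.inr _) => 1
  | .inr (.inl k) => 2 * Encodable.encode k + 2
  | .inr (.inr k) => 2 * Encodable.encode k + 3

omit [Group G] in
theorem finite_featureClass_preimage [Encodable K] (m : ℕ) :
    ((featureClass : FeatureIndex G K → ℕ) ⁻¹' {m}).Finite := by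
  have hinj : Function.Injective fun i : K ⊕ K => featureClass (.inr i : FeatureIndex G K) := by
    rintro (k | k) (l | l) h <;> simp only [featureClass] at h
    · rw [Encodable.encode_injective (show Encodable.encode k = Encodable.encode l by omega)]
    · omega
    · omega
    · rw [Encodable.encode_injective (show Encodable.encode k = Encodable.encode l by omega)]
  refine ((Set.finite_range (Sum.inl : _ → FeatureIndex G K)).union
    (((Set.finite_singleton m).preimage hinj.injOn).image Sum.inr)).subset ?_
  rintro (i | i) hi
  · exact Or.inl ⟨i, rfl⟩
  · exact Or.inr ⟨i, hi, rfl⟩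

/-- The permutation of the features induced by `g`. -/
def featurePerm (K : Type*) (g : G) : Equiv.Perm (FeatureIndex G K) :=
  Equiv.sumCongr (Equiv.sumCongr (Equiv.mulLeft g⁻¹)
    ((Equiv.mulLeft g⁻¹).subtypeEquiv fun _ => Iff.rfl)) (Equiv.refl _)

omit [Fintype G] in
theorem featureClass_featurePerm [Encodable K] (g : G) (i : FeatureIndex G K) :
    featureClass (featurePerm K g i) = featureClass i := by
  rcases i with (_ | _) | (_ | _) <;> rfl

variable [DecidableEq G]

theorem feature_shift (he : ∀ i j, e i (u j) = if i = j then 1 else 0)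
    (hψ : ∀ k i, ψ k (u i) = 0) (g : G) (i : FeatureIndex G K) (x : X) :
    feature e ψ i (shift u e g x) = feature e ψ (featurePerm K g i) x := by
  rcases i with (h | h) | (k | k)
  · exact biorthogonal_shift he g h x
  · change _ = feature e ψ (.inl (.inr ⟨g⁻¹ * h, h.2⟩)) x
    simp only [feature_generic, biorthogonal_shift he]
    rw [← Equiv.sum_comp (Equiv.mulLeft g⁻¹) fun i => distinctWeight ((g⁻¹ * ↑h)⁻¹ * i) * e i x]
    simp [mul_assoc]
  · exact apply_shift (hψ k) g x
  · change _ = feature e ψ (.inr (.inr k)) x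
    simp only [feature_sum_add, biorthogonal_shift he, apply_shift (hψ k)]
    rw [← Equiv.sum_comp (Equiv.mulLeft g⁻¹) fun i => e i x]
    simp

theorem feature_coord_basis (he : ∀ i j, e i (u j) = if i = j then 1 else 0) (g h : G) :
    feature e ψ (.inl (.inl g)) (u h) = if g = h then 1 else 0 := he g h

theorem feature_generic_basis (he : ∀ i j, e i (u j) = if i = j then 1 else 0)
    (g : {_g : G // Nontrivial G}) (h : G) :
    feature e ψ (.inl (.inr g)) (u h) = distinctWeight ((g : G)⁻¹ * h) := by
  simp [feature_generic, he]

theorem feature_sum_add_basis (he : ∀ i j, e i (u j) = if i = j then 1 else 0)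
    (hψ : ∀ k i, ψ k (u i) = 0) (k : K) (h : G) :
    feature e ψ (.inr (.inr k)) (u h) = 1 := by
  simp [feature_sum_add, he, hψ]

theorem feature_ne_zero (he : ∀ i j, e i (u j) = if i = j then 1 else 0)
    (hψ : ∀ k i, ψ k (u i) = 0) (hne : ∀ k, ∃ z, (∀ i, e i z = 0) ∧ ψ k z ≠ 0)
    (i : FeatureIndex G K) : feature e ψ i ≠ 0 := by
  intro h0
  rcases i with (g | g) | (k | k)
  · have := DFunLike.congr_fun h0 (u g)
    rw [feature_coord_basis he, if_pos rfl] at this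
    exact one_ne_zero this
  · have := DFunLike.congr_fun h0 (u g)
    rw [feature_generic_basis he] at this
    exact (distinctWeight_pos _).ne' this
  · obtain ⟨z, -, hz⟩ := hne k
    exact hz (DFunLike.congr_fun h0 z)
  · have := DFunLike.congr_fun h0 (u 1)
    rw [feature_sum_add_basis he hψ] at this
    exact one_ne_zero this

-- Both translates have the same positive sum over `G`, so `c = 1`; injectivity of the weight at `k
-- = 1` finishes.
omit [DecidableEq G] in
theorem eq_of_forall_distinctWeight_eq_mul {g g' : G} {c : ℝ}
    (h : ∀ k, distinctWeight (g' * k) = c * distinctWeight (g * k)) : g = g' := by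
  have h1 : ∑ k, distinctWeight (g' * k) = c * ∑ k, distinctWeight (g * k) := by
    rw [Finset.mul_sum]
    exact Finset.sum_congr rfl fun k _ => h k
  have hs : ∀ a : G, ∑ k, distinctWeight (a * k) = ∑ k, distinctWeight k := fun a =>
    Equiv.sum_comp (Equiv.mulLeft a) _
  have hpos : 0 < ∑ k : G, distinctWeight k :=
    Finset.sum_pos (fun k _ => distinctWeight_pos k) Finset.univ_nonempty
  rw [hs, hs, eq_comm] at h1
  have hc : c = 1 := by
    rw [mul_eq_right₀ hpos.ne'] at h1
    exact h1
  have h2 := h 1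
  rw [hc, one_mul, mul_one, mul_one] at h2
  exact (distinctWeight_injective h2).symm

theorem exists_feature_eq_zero_ne_zero (he : ∀ i j, e i (u j) = if i = j then 1 else 0)
    (hψ : ∀ k i, ψ k (u i) = 0) (hne : ∀ k, ∃ z, (∀ i, e i z = 0) ∧ ψ k z ≠ 0)
    (hind : ∀ k l, k ≠ l → ∃ z, (∀ i, e i z = 0) ∧ ψ k z = 0 ∧ ψ l z ≠ 0)
    (i j : FeatureIndex G K) (hij : i ≠ j) :
    ∃ x, feature e ψ i x = 0 ∧ feature e ψ j x ≠ 0 := by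
  -- Correcting `u g` within the common kernel of the `e h` kills `∑ h, e h + ψ k` and keeps the
  -- coordinates of `u g`.
  have hsep : ∀ k g, ∃ x, feature e ψ (.inr (.inr k)) x = 0 ∧ ψ k x = -1 ∧
      ∀ h, e h x = if h = g then 1 else 0 := fun k g => by
    obtain ⟨z, hz, hz'⟩ := hne k
    exact ⟨u g - (ψ k z)⁻¹ • z, by simp [feature_sum_add, he, hψ, hz, hz'], by simp [hψ, hz'],
      fun h => by simp [he, hz]⟩
  rcases i with (g | g) | (k | k)
  · rcases j with (h | h) | (l | l)
    · refine ⟨u h, ?_, ?_⟩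
      · rw [feature_coord_basis he, if_neg (fun h => hij (by rw [h]))]
      · rw [feature_coord_basis he, if_pos rfl]
        exact one_ne_zero
    · have := h.2
      obtain ⟨k, hk⟩ := exists_ne g
      refine ⟨u k, ?_, ?_⟩
      · rw [feature_coord_basis he, if_neg hk.symm]
      · rw [feature_generic_basis he]
        exact (distinctWeight_pos _).ne'
    · obtain ⟨z, hz, hz'⟩ := hne l
      exact ⟨z, hz g, hz'⟩
    · obtain ⟨z, hz, hz'⟩ := hne l
      exact ⟨z, hz g, by simpa [feature_sum_add, hz] using hz'⟩
  · rcases j with (h | h) | (l | l)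
    · have := g.2
      obtain ⟨k, hk⟩ := exists_ne h
      refine ⟨distinctWeight ((g : G)⁻¹ * k) • u h - distinctWeight ((g : G)⁻¹ * h) • u k, ?_, ?_⟩
      · rw [map_sub, map_smul, map_smul, feature_generic_basis he, feature_generic_basis he,
          smul_eq_mul, smul_eq_mul]
        ring
      · rw [map_sub, map_smul, map_smul, feature_coord_basis he, feature_coord_basis he,
          if_pos rfl, if_neg hk.symm]
        simpa using (distinctWeight_pos _).ne'
    · by_contra! hcon
      refine hij ?_
      have key : ∀ k, distinctWeight ((h : G)⁻¹ * k) =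
          distinctWeight ((h : G)⁻¹ * g) / distinctWeight ((g : G)⁻¹ * g) *
            distinctWeight ((g : G)⁻¹ * k) := fun k => by
        have h1 := hcon (u k - (distinctWeight ((g : G)⁻¹ * k) /
          distinctWeight ((g : G)⁻¹ * g)) • u g) (by
            rw [map_sub, map_smul, feature_generic_basis he, feature_generic_basis he,
              smul_eq_mul, div_mul_cancel₀ _ (distinctWeight_pos _).ne', sub_self])
        rw [map_sub, map_smul, feature_generic_basis he, feature_generic_basis he,
          sub_eq_zero, smul_eq_mul] at h1
        rw [h1]
        ring
      have := eq_of_forall_distinctWeight_eq_mul key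
      rw [inv_inj] at this
      rw [Subtype.ext this]
    · obtain ⟨z, hz, hz'⟩ := hne l
      exact ⟨z, by simp [feature_generic, hz], hz'⟩
    · obtain ⟨z, hz, hz'⟩ := hne l
      exact ⟨z, by simp [feature_generic, hz], by simpa [feature_sum_add, hz] using hz'⟩
  · rcases j with (h | h) | (l | l)
    · refine ⟨u h, hψ k h, ?_⟩
      rw [feature_coord_basis he, if_pos rfl]
      exact one_ne_zero
    · refine ⟨u h, hψ k h, ?_⟩
      rw [feature_generic_basis he]
      exact (distinctWeight_pos _).ne'
    · obtain ⟨z, -, hz, hz'⟩ := hind k l fun h => hij (by rw [h])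
      exact ⟨z, hz, hz'⟩
    · refine ⟨u 1, hψ k 1, ?_⟩
      rw [feature_sum_add_basis he hψ]
      exact one_ne_zero
  · rcases j with (h | h) | (l | l)
    · obtain ⟨x, hx, -, hx'⟩ := hsep k h
      exact ⟨x, hx, by simp [feature_coord, hx']⟩
    · obtain ⟨x, hx, -, hx'⟩ := hsep k h
      exact ⟨x, hx, by simpa [feature_generic, hx'] using (distinctWeight_pos _).ne'⟩
    · by_cases hkl : k = l
      · subst hkl
        obtain ⟨x, hx, hx', -⟩ := hsep k 1
        exact ⟨x, hx, by simp [feature_fixed, hx']⟩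
      · obtain ⟨z, h1, h2, h3⟩ := hind k l hkl
        exact ⟨z, by simp [feature_sum_add, h1, h2], h3⟩
    · obtain ⟨z, h1, h2, h3⟩ := hind k l fun h => hij (by rw [h])
      exact ⟨z, by simp [feature_sum_add, h1, h2], by simpa [feature_sum_add, h1] using h3⟩

/-- A linear bijection that permutes the features up to sign within each class is a signed
shift. -/
theorem exists_signedShift_of_permutes_features [Encodable K]
    (he : ∀ i j, e i (u j) = if i = j then 1 else 0)
    (hψ : ∀ k i, ψ k (u i) = 0) (hne : ∀ k, ∃ z, (∀ i, e i z = 0) ∧ ψ k z ≠ 0)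
    (htot : ∀ x, (∀ i, e i x = 0) → (∀ k, ψ k x = 0) → x = 0) (T : X ≃ₗ[ℝ] X)
    (hT : ∀ i : FeatureIndex G K, ∃ j, featureClass i = featureClass j ∧
      ∃ ε : ℝ, (ε = 1 ∨ ε = -1) ∧ ∀ x, feature e ψ i (T x) = ε * feature e ψ j x) :
    ∃ g : G, ∃ ε : ℝ, (ε = 1 ∨ ε = -1) ∧ ∀ x, T x = ε • shift u e g x := by
  have hcoord : ∀ g, ∃ h, ∃ ε : ℝ, (ε = 1 ∨ ε = -1) ∧ ∀ x, e g (T x) = ε * e h x := fun g => by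
    obtain ⟨(h | h) | (l | l), hcl, ε, hε, hx⟩ := hT (.inl (.inl g)) <;>
      simp only [featureClass] at hcl
    · exact ⟨h, ε, hε, hx⟩
    all_goals omega
  choose σ ε hε hσ using hcoord
  have hσinj : Function.Injective σ := fun a b hab => by
    by_contra hne'
    obtain ⟨x, hx⟩ := T.surjective (u a)
    have ha := hσ a x
    have hb := hσ b x
    rw [hx, he, if_pos rfl] at ha
    rw [hx, he, if_neg (Ne.symm hne'), ← hab] at hb
    have : e (σ a) x = 0 := by
      rcases hε b with h | h <;> rw [h] at hb <;> linarith
    rw [this, mul_zero] at ha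
    exact one_ne_zero ha
  obtain ⟨g, δ, hδ, hg⟩ : ∃ g, ∃ δ : ℝ, (δ = 1 ∨ δ = -1) ∧
      ∀ h x, e h (T x) = δ * e (g * h) x := by
    rcases subsingleton_or_nontrivial G with hG | hG
    · exact ⟨1, ε 1, hε 1, fun h x => by
        rw [Subsingleton.elim h 1, hσ, Subsingleton.elim (σ 1) (1 * 1)]⟩
    · obtain ⟨g, δ, hδ, hx⟩ : ∃ g : G, ∃ δ : ℝ, (δ = 1 ∨ δ = -1) ∧ ∀ x,
          ∑ h, distinctWeight h * e h (T x) = δ * ∑ h, distinctWeight (g⁻¹ * h) * e h x := by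
        obtain ⟨(h | h) | (l | l), hcl, δ, hδ, hx⟩ := hT (.inl (.inr ⟨1, hG⟩)) <;>
          simp only [featureClass] at hcl
        · omega
        · exact ⟨h, δ, hδ, fun x => by simpa [feature_generic] using hx x⟩
        all_goals omega
      have key : ∀ k, distinctWeight k * ε k = δ * distinctWeight (g⁻¹ * σ k) := fun k => by
        have := hx (u (σ k))
        simpa [hσ, he, hσinj.eq_iff] using this
      -- Positivity of the weights separates sign from size in `key`; their injectivity then
      -- determines `σ k`.
      have hkey : ∀ k, σ k = g * k ∧ ε k = δ := fun k => by
        have h1 := key k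
        have p1 := distinctWeight_pos k
        have p2 := distinctWeight_pos (g⁻¹ * σ k)
        have h2 : distinctWeight k = distinctWeight (g⁻¹ * σ k) ∧ ε k = δ := by
          rcases hε k with h | h <;> rcases hδ with h' | h' <;> rw [h, h'] at h1 ⊢ <;>
            constructor <;> linarith
        exact ⟨(eq_inv_mul_iff_mul_eq.1 (distinctWeight_injective h2.1)).symm, h2.2⟩
      exact ⟨g, δ, hδ, fun h x => by rw [hσ, (hkey h).1, (hkey h).2]⟩
  have hfix : ∀ k x, ψ k (T x) = δ * ψ k x := fun k x => by
    obtain ⟨δ₁, hδ₁, h1⟩ : ∃ δ₁ : ℝ, (δ₁ = 1 ∨ δ₁ = -1) ∧ ∀ x, ψ k (T x) = δ₁ * ψ k x := by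
      obtain ⟨(h | h) | (l | l), hcl, δ₁, hδ₁, hx⟩ := hT (.inr (.inl k)) <;>
        simp only [featureClass] at hcl
      · omega
      · omega
      · have hkl : k = l := Encodable.encode_injective (by omega)
        subst hkl
        exact ⟨δ₁, hδ₁, hx⟩
      · omega
    obtain ⟨δ₂, hδ₂, h2⟩ : ∃ δ₂ : ℝ, (δ₂ = 1 ∨ δ₂ = -1) ∧ ∀ x,
        ∑ h, e h (T x) + ψ k (T x) = δ₂ * (∑ h, e h x + ψ k x) := by
      obtain ⟨(h | h) | (l | l), hcl, δ₂, hδ₂, hx⟩ := hT (.inr (.inr k)) <;>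
        simp only [featureClass] at hcl
      · omega
      · omega
      · omega
      · have hkl : k = l := Encodable.encode_injective (by omega)
        subst hkl
        exact ⟨δ₂, hδ₂, fun x => by simpa only [feature_sum_add] using hx x⟩
    have hsum : ∀ x, ∑ h, e h (T x) = δ * ∑ h, e h x := fun x => by
      simp only [hg, ← Finset.mul_sum]
      rw [← Equiv.sum_comp (Equiv.mulLeft g) fun h => e h x]
      rfl
    -- Evaluation at `u 1`, where `ψ k` vanishes, gives `δ₂ = δ`; evaluation at `z`, where every `e
    -- h` vanishes, gives `δ₁ = δ₂`.
    have h3 := h2 (u 1)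
    rw [hsum, h1, hψ] at h3
    simp only [he, Finset.sum_ite_eq', Finset.mem_univ, if_true, mul_zero, add_zero,
      mul_one] at h3
    obtain ⟨z, hz, hz'⟩ := hne k
    have h4 := h2 z
    rw [hsum, h1] at h4
    simp only [hz, Finset.sum_const_zero, mul_zero, zero_add] at h4
    rw [h1, mul_right_cancel₀ hz' h4, h3]
  have hδδ : δ * δ = 1 := by rcases hδ with h | h <;> rw [h] <;> norm_num
  -- The inverse appears because a shift acts on coordinates contragrediently.
  refine ⟨g⁻¹, δ, hδ, fun x => sub_eq_zero.1 (htot _ (fun i => ?_) fun k => ?_)⟩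
  · rw [map_sub, map_smul, biorthogonal_shift he, hg, inv_inv, smul_eq_mul, sub_self]
  · rw [map_sub, map_smul, apply_shift (hψ k), hfix, smul_eq_mul, sub_self]

end Features

/-! ### Assembling the norm -/

/-- A linear bijection of a line that is isometric for some norm is `± 1`. -/
theorem exists_eq_smul_of_isometry_of_injective {X : Type*} [NormedAddCommGroup X]
    [NormedSpace ℝ X] {p : Seminorm ℝ X} (hp : IsEquivalentNorm p) {f : StrongDual ℝ X}
    (hf : Function.Injective f) {v : X} (hv : f v = 1) {T : X ≃ₗ[ℝ] X}
    (hT : T ∈ isometryGroup p) : ∃ ε : ℝ, (ε = 1 ∨ ε = -1) ∧ ∀ x, T x = ε • x := by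
  have hT : ∀ x, p (T x) = p x := hT
  have hx : ∀ x, x = f x • v := fun x => hf (by rw [map_smul, hv, smul_eq_mul, mul_one])
  have hv0 : v ≠ 0 := fun h => by rw [h, map_zero] at hv; exact zero_ne_one hv
  have h1 := hT v
  rw [hx (T v), map_smul_eq_mul, Real.norm_eq_abs, mul_eq_right₀ (hp.pos hv0).ne'] at h1
  refine ⟨f (T v), ?_, fun x => ?_⟩
  · rcases abs_cases (f (T v)) with h | h
    · left; linarith
    · right; linarith
  · rw [hx x, map_smul T, smul_comm, ← hx (T v)]

theorem exists_biorthogonal_of_card_le_rank {G : Type*} [Fintype G] [DecidableEq G] {X : Type*}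
    [NormedAddCommGroup X] [NormedSpace ℝ X]
    (hdim : (Nat.card G : Cardinal) ≤ Module.rank ℝ X) :
    ∃ (u : G → X) (e : G → StrongDual ℝ X), ∀ i j, e i (u j) = if i = j then 1 else 0 := by
  obtain ⟨s, hs, hli⟩ := le_rank_iff_exists_linearIndependent_finset.1 hdim
  have hcard : Fintype.card G = Fintype.card s := by
    rw [Fintype.card_coe, hs, Nat.card_eq_fintype_card]
  let φ : G ≃ s := Fintype.equivOfCardEq hcard
  have hu : LinearIndependent ℝ fun g => (φ g : X) := hli.comp φ φ.injective
  obtain ⟨e, he⟩ := hu.exists_biorthogonal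
  exact ⟨_, e, he⟩

theorem theorem2p8 (G : Type*) [Group G] [Finite G]
    (X : Type*) [NormedAddCommGroup X] [NormedSpace ℝ X] [CompleteSpace X]
    [TopologicalSpace.SeparableSpace X]
    (hdim : (Nat.card G : Cardinal) ≤ Module.rank ℝ X) :
    IsRepresentableIn (ℤˣ × G) X := by
  classical
  have := Fintype.ofFinite G
  obtain ⟨u, e, he⟩ := exists_biorthogonal_of_card_le_rank hdim
  obtain ⟨K, hK, hψ, htot, hne, hind⟩ := exists_total_extension he
  have := hK.to_subtype
  have := Encodable.ofCountable K
  let ψ : K → StrongDual ℝ X := Subtype.val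
  replace hψ : ∀ k i, ψ k (u i) = 0 := fun k => hψ k k.2
  replace htot : ∀ x, (∀ i, e i x = 0) → (∀ k, ψ k x = 0) → x = 0 := fun x h1 h2 =>
    htot x h1 fun k hk => h2 ⟨k, hk⟩
  replace hne : ∀ k, ∃ z, (∀ i, e i z = 0) ∧ ψ k z ≠ 0 := fun k => hne k k.2
  replace hind : ∀ k l, k ≠ l → ∃ z, (∀ i, e i z = 0) ∧ ψ k z = 0 ∧ ψ l z ≠ 0 :=
    fun k l hkl => hind k k.2 l l.2 fun h => hkl (Subtype.ext h)
  obtain ⟨q, hq, hqs⟩ := exists_gateauxSmooth_equivalentNorm X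
  set Q := shiftAverage u e q with hQ
  have hQs : IsGateauxSmooth Q := isGateauxSmooth_shiftAverage he hqs
  have hQe : IsEquivalentNorm Q := isEquivalentNorm_shiftAverage hq
  obtain ⟨c, C, hc, hC, hcC⟩ := id hQe
  let F : FeatureIndex G K → StrongDual ℝ X := feature e ψ
  obtain ⟨w, hw, hws, hw1, hwκ⟩ := exists_weights featureClass finite_featureClass_preimage
    (fun i => ‖F i‖) (fun i => norm_pos_iff.2 (feature_ne_zero he hψ hne i))
    -- Functionals of total norm at most `1` give `c * ‖x‖ ≤ p x ≤ (C + 1) * ‖x‖`. An isometry thus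
    -- changes dual norms by a factor at most `(C + 1) / c`, too little to cross between classes.
    (show 0 < c / (C + 1) by positivity)
  let φ : FeatureIndex G K → StrongDual ℝ X := fun i => w (featureClass i) • F i
  have hφn : ∀ i, ‖φ i‖ = w (featureClass i) * ‖F i‖ := fun i => by
    rw [norm_smul, Real.norm_eq_abs, abs_of_pos (hw _)]
  have hφ : Summable fun i => ‖φ i‖ := by simpa only [hφn] using hws
  set p := addAbsSum Q φ hφ with hp
  have hpe : IsEquivalentNorm p := isEquivalentNorm_addAbsSum hQe
  have hpb : ∀ x, c * ‖x‖ ≤ p x ∧ p x ≤ (C + 1) * ‖x‖ := fun x =>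
    ⟨(hcC x).1.trans (le_addAbsSum x), (addAbsSum_le (fun x => (hcC x).2) x).trans
      (by gcongr; simpa only [hφn] using hw1)⟩
  have hshift : ∀ g x, p (shift u e g x) = p x := fun g x => by
    rw [hp, addAbsSum_apply, addAbsSum_apply, hQ, shiftAverage_shift he]
    congr 1
    rw [← Equiv.tsum_eq (featurePerm K g) fun i => |φ i x|]
    refine tsum_congr fun i => ?_
    simp only [φ, F, smul_apply, feature_shift he hψ, featureClass_featurePerm]
  have hmem : ∀ a, signedShiftHom he a ∈ isometryGroup p := fun ⟨ε, g⟩ x => by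
    rw [signedShiftHom_apply]
    rcases Int.units_eq_one_or ε with rfl | rfl
    · rw [one_smul, hshift]
    · rw [Units.neg_smul, one_smul, map_neg_eq_map, hshift]
  refine ⟨p, hpe, ⟨MulEquiv.ofBijective ((signedShiftHom he).codRestrict _ hmem)
    ⟨fun a b h => injective_signedShiftHom he (congrArg Subtype.val h), ?_⟩⟩⟩
  rintro ⟨T, hT⟩
  obtain ⟨g, ε, hε, hTg⟩ : ∃ g : G, ∃ ε : ℝ, (ε = 1 ∨ ε = -1) ∧ ∀ x, T x = ε • shift u e g x := by
    -- With a single feature, `G` is trivial, `K` is empty and `X` is a line; with no second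
    -- functional the kink argument does not apply.
    rcases subsingleton_or_nontrivial (FeatureIndex G K) with hsub | hnon
    · have hinj : Function.Injective (e 1) := by
        rw [injective_iff_map_eq_zero]
        intro x hx
        refine htot x (fun i => ?_) fun k => ?_
        · rwa [Sum.inl_injective (Sum.inl_injective
            (hsub.elim (.inl (.inl i)) (.inl (.inl 1) : FeatureIndex G K)))]
        · exact absurd (hsub.elim (.inl (.inl 1)) (.inr (.inl k))) Sum.inl_ne_inr
      obtain ⟨ε, hε, h⟩ := exists_eq_smul_of_isometry_of_injective hpe hinj
        (v := u 1) (by rw [he, if_pos rfl]) hT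
      exact ⟨1, ε, hε, fun x => by rw [h, shift_one]⟩
    · refine exists_signedShift_of_permutes_features he hψ hne htot T fun i => ?_
      have hprop : ∀ i j, i ≠ j → ∃ x, φ i x = 0 ∧ φ j x ≠ 0 := fun i j hij => by
        obtain ⟨x, h1, h2⟩ := exists_feature_eq_zero_ne_zero he hψ hne hind i j hij
        exact ⟨x, by simp [φ, F, h1], by simp [φ, F, h2, (hw _).ne']⟩
      obtain ⟨j, ε, hε, h⟩ := exists_apply_isometry_eq hQs hprop hT i
      obtain ⟨h1, h2⟩ := norm_le_of_apply_isometry_eq hc hpb (by positivity) hT hε h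
      have hκ : ∀ a b : ℝ, a ≤ (C + 1) / c * b → c / (C + 1) * a ≤ b := fun a b hab => by
        rw [div_mul_eq_mul_div, le_div_iff₀ hc] at hab
        rw [div_mul_eq_mul_div, div_le_iff₀ (by positivity)]
        linarith
      have hcl : featureClass i = featureClass j := by
        simp only [hφn] at h1 h2
        rcases lt_trichotomy (featureClass i) (featureClass j) with hlt | heq | hlt
        · exact absurd (hwκ i j hlt) (not_lt.2 (hκ _ _ h1))
        · exact heq
        · exact absurd (hwκ j i hlt) (not_lt.2 (hκ _ _ h2))
      refine ⟨j, hcl, ε, hε, fun x => ?_⟩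
      have := h x
      simp only [φ, smul_apply, smul_eq_mul, ← hcl] at this
      refine mul_left_cancel₀ (hw (featureClass i)).ne' (this.trans ?_)
      ring
  rcases hε with rfl | rfl
  · refine ⟨(1, g), Subtype.ext (LinearEquiv.ext fun x => ?_)⟩
    change signedShiftHom he (1, g) x = T x
    rw [signedShiftHom_apply, hTg, one_smul, one_smul]
  · refine ⟨(-1, g), Subtype.ext (LinearEquiv.ext fun x => ?_)⟩
    change signedShiftHom he (-1, g) x = T x
    rw [signedShiftHom_apply, hTg, Units.neg_smul, one_smul, neg_smul, one_smul]
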